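/- All graphs are finite, simple and undirected. For a graph $G$, let $|G|$ be its number of vertices, $\|G\|$ its number of edges and $\Delta(G)$ its maximum degree. A tree decomposition of $G$ is a family $(B_x)_{x\in V(T)}$ of subsets of $V(G)$ (bags), indexed by the vertices of a finite tree $T$, such that every edge of $G$ has both ends in some $B_x$, and for every $v\in V(G)$ the set $\{x : v\in B_x\}$ induces a non-empty connected subgraph of $T$; its width is the size of a largest bag minus $1$, and the treewidth of $G$ is the minimum width of a tree decomposition of $G$ (the treewidth of the graph with no vertices being taken as $0$). A set $P$ of points in the plane is in general position if no three points of $P$ are collinear and no three distinct line-segments between pairs of points of $P$ meet in a common point, unless all three share a common endpoint. A rectilinear drawing of $G$ represents the vertices by $|G|$ distinct points in general position in the plane and every edge by the line-segment between its ends; its crossings are the unordered pairs of edges that have no common end and whose line-segments intersect. The rectilinear crossing number $\overline{\mathrm{cr}}(G)$ is the minimum number of crossings over all rectilinear drawings of $G$. Theorem. (1) For every integer $k\ge 1$, every graph $G$ of treewidth at most $k$ satisfies $$\overline{\mathrm{cr}}(G)\;\le\; k(k+2)\,\Delta(G)\,\|G\|.$$ (2) Consequently, for every integer $k\ge1$ there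 is a constant $c_k$ such that every graph $G$ of treewidth at most $k$ satisfies $\overline{\mathrm{cr}}(G)\le c_k\,\Delta(G)\,|G|$. (3) The dependence on $\Delta(G)$ and $|G|$ in (2) is best possible: there is a constant $C>0$ such that for all integers $d\ge 3$ and $n\ge C d$ there is an $n$-vertex graph $G$ of treewidth at most $5$ with $\Delta(G)=d$ and $\overline{\mathrm{cr}}(G)\ge d\,n/C$. -/

import Mathlib

universe u

/-- An `H`-decomposition of a graph `G`: a family of bags (sets of vertices of `G`) indexed by the
vertices of `H`, such that the ends of every edge of `G` lie in a common bag, and for every vertex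
`v` of `G` the indices of the bags containing `v` induce a non-empty connected subgraph of `H`.
(`SimpleGraph.Connected` includes non-emptiness.) -/
structure SimpleGraph.Decomposition {V W : Type*} (G : SimpleGraph V) (H : SimpleGraph W) where
  bag : W → Finset V
  exists_bag_of_adj : ∀ v w : V, G.Adj v w → ∃ x : W, v ∈ bag x ∧ w ∈ bag x
  connected_bags : ∀ v : V, (H.induce {x : W | v ∈ bag x}).Connected

/-- The width of a decomposition: the size of a largest bag, minus one.
(The subtraction is truncated only if all bags are empty, that is, if `G` has no vertices.) -/
def SimpleGraph.Decomposition.width {V W : Type*} [Fintype W] {G : SimpleGraph V}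
    {H : SimpleGraph W} (D : G.Decomposition H) : ℕ :=
  (Finset.univ.sup fun x : W => (D.bag x).card) - 1

/-- The treewidth of a graph: the minimum width of a decomposition of it indexed by the vertices of
a finite tree. -/
noncomputable def SimpleGraph.treewidth {V : Type*} (G : SimpleGraph V) : ℕ :=
  sInf {w : ℕ | ∃ (n : ℕ) (T : SimpleGraph (Fin n)) (D : G.Decomposition T),
    T.IsTree ∧ D.width = w}

/-- A finite graph has a tree decomposition, so the minimum defining the treewidth is attained. -/
theorem SimpleGraph.exists_decomposition_width_eq_treewidth {V : Type*} [Fintype V]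
    (G : SimpleGraph V) :
    ∃ (n : ℕ) (T : SimpleGraph (Fin n)) (D : G.Decomposition T),
      T.IsTree ∧ D.width = G.treewidth := by
  have hne : {w : ℕ | ∃ (n : ℕ) (T : SimpleGraph (Fin n)) (D : G.Decomposition T),
      T.IsTree ∧ D.width = w}.Nonempty := by
    refine ⟨_, 1, ⊥, ⟨fun _ => Finset.univ, fun v w _ => ⟨0, by simp, by simp⟩, fun v => ?_⟩,
      ?_, rfl⟩
    · have : Nonempty {x : Fin 1 | v ∈ (Finset.univ : Finset V)} := ⟨⟨0, by simp⟩⟩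
      exact ⟨fun a b => by rw [Subsingleton.elim a b]⟩
    · exact SimpleGraph.IsTree.of_subsingleton
  exact Nat.sInf_mem hne

/-- The Euclidean plane. -/
abbrev Plane : Type := EuclideanSpace ℝ (Fin 2)

/-- The closed line-segment spanned by an unordered pair of points of the plane. -/
def pairSegment (e : Sym2 Plane) : Set Plane :=
  Sym2.lift ⟨fun a b => segment ℝ a b, fun a b => segment_symm ℝ a b⟩ e

/-- A set `P` of points of the plane is in general position if no three points of `P` lie on one
line, and no three distinct line-segments between pairs of points of `P` have a point in common
unless all three segments share a common endpoint. -/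
structure InGeneralPosition (P : Set Plane) : Prop where
  not_collinear : ∀ a ∈ P, ∀ b ∈ P, ∀ c ∈ P, a ≠ b → a ≠ c → b ≠ c →
    ¬ Collinear ℝ ({a, b, c} : Set Plane)
  not_concurrent : ∀ e₁ e₂ e₃ : Sym2 Plane,
    (∀ a ∈ e₁, a ∈ P) → (∀ a ∈ e₂, a ∈ P) → (∀ a ∈ e₃, a ∈ P) →
    ¬ e₁.IsDiag → ¬ e₂.IsDiag → ¬ e₃.IsDiag → e₁ ≠ e₂ → e₁ ≠ e₃ → e₂ ≠ e₃ →
    (pairSegment e₁ ∩ pairSegment e₂ ∩ pairSegment e₃).Nonempty →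
    ∃ a, a ∈ e₁ ∧ a ∈ e₂ ∧ a ∈ e₃

/-- A rectilinear drawing of a graph: the vertices are represented by distinct points of the plane
in general position; each edge is represented by the line-segment between its ends. -/
structure SimpleGraph.RectilinearDrawing {V : Type*} (G : SimpleGraph V) where
  point : V → Plane
  injective : Function.Injective point
  generalPosition : InGeneralPosition (Set.range point)

namespace SimpleGraph.RectilinearDrawing

variable {V : Type*} {G : SimpleGraph V}

/-- The line-segment representing the pair `e` of vertices. -/
def edgeSegment (D : G.RectilinearDrawing) (e : Sym2 V) : Set Plane :=
  pairSegment (e.map D.point)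

/-- The crossing-pairs of a rectilinear drawing: unordered pairs of edges that have no end in
common and whose line-segments intersect. -/
def crossingPairs (D : G.RectilinearDrawing) : Set (Sym2 (Sym2 V)) :=
  {q | ∃ e f : Sym2 V, q = s(e, f) ∧ e ∈ G.edgeSet ∧ f ∈ G.edgeSet ∧
    (∀ v, ¬ (v ∈ e ∧ v ∈ f)) ∧ (D.edgeSegment e ∩ D.edgeSegment f).Nonempty}

/-- The number of crossings of a rectilinear drawing. -/
noncomputable def crossings (D : G.RectilinearDrawing) : ℕ∞ :=
  D.crossingPairs.encard

end SimpleGraph.RectilinearDrawing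

/-- The rectilinear crossing number of a graph: the minimum number of crossings over all its
rectilinear drawings. -/
noncomputable def SimpleGraph.rectilinearCrossingNumber {V : Type*} (G : SimpleGraph V) : ℕ∞ :=
  ⨅ D : G.RectilinearDrawing, D.crossings

/-! Upper bound. Root the tree of a decomposition of width at most `k` and order the vertices of `G`
by the topmost node whose bag contains them, breaking ties arbitrarily. This is a forest order in
which adjacent vertices are comparable (`Decomposition.exists_partialOrder`). Place each vertex very
close to its parent, in general position; then segments between points outside a subtree avoid the
convex hull of that subtree (`exists_nested_points`). So if edges `vw` and `ab` with lower ends `w`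
and `b` cross, then `b ≤ v` and `w ≤ a`, hence `w` and `b` are comparable. If `w < b`, then `w` lies
in the set `B b` of at most `k` vertices, and the crossing is charged to `ab`: there are `k` choices
for `w` and Δ for `v`. This gives at most `k`Δ‖G‖ crossings, which is stronger than (1); (2) follows
from ‖G‖ ≤ `k`|G|.

Lower bound. Take disjoint copies of `K_{3,d}`, whose treewidth is at most 3. The three vertices of
the small side form a triangle, which splits the other points into two classes such that any two
points of one class force a crossing between edges to distinct corners
(`InGeneralPosition.exists_classes`). Quadratically many pairs lie in one class, and distinct pairs
give distinct crossings. -/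

open MeasureTheory

/-! ### General position in the plane. -/

/-- Every ball of the plane contains a point outside any given finite family of lines. -/
theorem exists_dist_lt_forall_notMem_line (L : Set (Plane × Plane)) (hL : L.Finite) (x : Plane)
    {δ : ℝ} (hδ : 0 < δ) :
    ∃ q, dist q x < δ ∧ ∀ l ∈ L, q ∉ line[ℝ, l.1, l.2] := by
  have hnull : volume (⋃ l ∈ L, (line[ℝ, l.1, l.2] : Set Plane)) = 0 := by
    rw [measure_biUnion_null_iff hL.countable]
    intro l _
    refine Measure.addHaar_affineSubspace volume _ fun h => ?_
    have h1 : Module.finrank ℝ (vectorSpan ℝ ({l.1, l.2} : Set Plane)) ≤ 1 :=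
      collinear_iff_finrank_le_one.1 (collinear_pair ℝ l.1 l.2)
    rw [← direction_affineSpan, h, AffineSubspace.direction_top, finrank_top] at h1
    simp at h1
  by_contra! hcon
  have hsub : Metric.ball x δ ⊆ ⋃ l ∈ L, (line[ℝ, l.1, l.2] : Set Plane) := by
    intro q hq
    obtain ⟨l, hl, hql⟩ := hcon q hq
    exact Set.mem_biUnion hl hql
  exact (Metric.measure_ball_pos volume x hδ).ne' (measure_mono_null hsub hnull)

theorem mem_line_of_mem_segment {a b z : Plane} (h : z ∈ segment ℝ a b) : z ∈ line[ℝ, a, b] := by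
  rw [segment_eq_image_lineMap] at h
  obtain ⟨t, _, rfl⟩ := h
  exact AffineMap.lineMap_mem_affineSpan_pair t a b

theorem collinear_of_mem_segment {a b z : Plane} (h : z ∈ segment ℝ a b) :
    Collinear ℝ ({z, a, b} : Set Plane) :=
  collinear_insert_of_mem_affineSpan_pair (mem_line_of_mem_segment h)

/-- If two segments with a common endpoint meet elsewhere, then they are collinear. -/
theorem eq_of_mem_segments {q a b z : Plane} (h : ¬ Collinear ℝ ({q, a, b} : Set Plane))
    (ha : z ∈ segment ℝ q a) (hb : z ∈ segment ℝ q b) : z = q := by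
  by_contra hz
  have h1 : a ∈ line[ℝ, q, z] := (collinear_of_mem_segment ha).mem_affineSpan_of_mem_of_ne
    (by simp) (by simp) (by simp) (Ne.symm hz)
  have h2 : b ∈ line[ℝ, q, z] := (collinear_of_mem_segment hb).mem_affineSpan_of_mem_of_ne
    (by simp) (by simp) (by simp) (Ne.symm hz)
  exact h (collinear_triple_of_mem_affineSpan_pair (left_mem_affineSpan_pair _ _ _) h1 h2)

namespace InGeneralPosition

variable {P : Set Plane}

theorem empty : InGeneralPosition ∅ where
  not_collinear := by simp
  not_concurrent e₁ e₂ e₃ h := by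
    induction e₁ with | h a b => exact absurd (h a (by simp)) (by simp)

theorem mono {Q : Set Plane} (hP : InGeneralPosition P) (h : Q ⊆ P) : InGeneralPosition Q where
  not_collinear a ha b hb c hc := hP.not_collinear a (h ha) b (h hb) c (h hc)
  not_concurrent e₁ e₂ e₃ h₁ h₂ h₃ := hP.not_concurrent e₁ e₂ e₃ (fun a ha => h (h₁ a ha))
    (fun a ha => h (h₂ a ha)) (fun a ha => h (h₃ a ha))

/-- A point of the set on a segment between two of its points is an endpoint of that segment. -/
theorem mem_of_mem_pairSegment (hP : InGeneralPosition P) {e : Sym2 Plane} (he : ∀ a ∈ e, a ∈ P)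
    (hd : ¬ e.IsDiag) {z : Plane} (hz : z ∈ P) (h : z ∈ pairSegment e) : z ∈ e := by
  induction e with
  | h a b =>
    by_contra hcon
    rw [Sym2.mem_iff, not_or] at hcon
    exact hP.not_collinear z hz a (he a (by simp)) b (he b (by simp)) hcon.1 hcon.2
      (by simpa using hd) (collinear_of_mem_segment h)

/-- Two distinct segments between points of a set in general position have at most one point in
common. -/
theorem subsingleton_inter (hP : InGeneralPosition P) {e f : Sym2 Plane} (he : ∀ a ∈ e, a ∈ P)
    (hf : ∀ a ∈ f, a ∈ P) (hde : ¬ e.IsDiag) (hdf : ¬ f.IsDiag) (hef : e ≠ f) :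
    (pairSegment e ∩ pairSegment f).Subsingleton := by
  rintro z ⟨hze, hzf⟩ w ⟨hwe, hwf⟩
  by_contra hzw
  induction e with
  | h a b =>
  induction f with
  | h c d =>
  -- Two common points would put all four endpoints on the line `zw`, which contains at most two
  -- points of `P`.
  have key : ∀ a b : Plane, z ∈ segment ℝ a b → w ∈ segment ℝ a b → a ∈ line[ℝ, z, w] := by
    intro a b h1 h2
    have := collinear_insert_insert_of_mem_affineSpan_pair (mem_line_of_mem_segment h1)
      (mem_line_of_mem_segment h2)
    exact this.mem_affineSpan_of_mem_of_ne (by simp) (by simp) (by simp) hzw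
  have ha := key a b hze hwe
  have hb := key b a (segment_symm ℝ a b ▸ hze) (segment_symm ℝ a b ▸ hwe)
  have hc := key c d hzf hwf
  have hd := key d c (segment_symm ℝ c d ▸ hzf) (segment_symm ℝ c d ▸ hwf)
  have hab : a ≠ b := by simpa using hde
  have hcd : c ≠ d := by simpa using hdf
  have h3 : ∀ x ∈ P, x ∈ line[ℝ, z, w] → x = a ∨ x = b := by
    intro x hx hxl
    by_contra! hcon
    exact hP.not_collinear x hx a (he a (by simp)) b (he b (by simp)) hcon.1 hcon.2 hab
      (collinear_triple_of_mem_affineSpan_pair hxl ha hb)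
  rcases h3 c (hf c (by simp)) hc with rfl | rfl <;>
  rcases h3 d (hf d (by simp)) hd with rfl | rfl
  · exact hcd rfl
  · exact hef rfl
  · exact hef Sym2.eq_swap
  · exact hcd rfl

/-- The pairwise intersection points of the segments between points of `P`. -/
def crossingPoints (P : Set Plane) : Set Plane :=
  {z | ∃ e f : Sym2 Plane, (∀ a ∈ e, a ∈ P) ∧ (∀ a ∈ f, a ∈ P) ∧ ¬ e.IsDiag ∧ ¬ f.IsDiag ∧ e ≠ f ∧
    z ∈ pairSegment e ∧ z ∈ pairSegment f}

theorem finite_crossingPoints (hP : InGeneralPosition P) (hfin : P.Finite) :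
    (crossingPoints P).Finite := by
  have hE : {e : Sym2 Plane | ∀ a ∈ e, a ∈ P}.Finite := by
    refine ((hfin.prod hfin).image fun x => s(x.1, x.2)).subset ?_
    intro e he
    induction e with
    | h a b => exact ⟨(a, b), ⟨he a (by simp), he b (by simp)⟩, rfl⟩
  have h2 : (⋃ x ∈ {x : Sym2 Plane × Sym2 Plane | (∀ a ∈ x.1, a ∈ P) ∧ (∀ a ∈ x.2, a ∈ P) ∧
      ¬ x.1.IsDiag ∧ ¬ x.2.IsDiag ∧ x.1 ≠ x.2}, pairSegment x.1 ∩ pairSegment x.2).Finite := by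
    refine Set.Finite.biUnion ((hE.prod hE).subset ?_) ?_
    · rintro x ⟨h1, h2, -⟩
      exact ⟨h1, h2⟩
    · rintro x ⟨h1, h2, h3, h4, h5⟩
      exact (hP.subsingleton_inter h1 h2 h3 h4 h5).finite
  refine h2.subset ?_
  rintro z ⟨e, f, h1, h2, h3, h4, h5, h6, h7⟩
  exact Set.mem_biUnion (x := (e, f)) ⟨h1, h2, h3, h4, h5⟩ ⟨h6, h7⟩

/-- General position is preserved by adding a point that avoids all lines through two points that
belong to the set or are intersection points of segments between its points. -/
theorem insert (hP : InGeneralPosition P) {q : Plane}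
    (hq : ∀ a ∈ P ∪ crossingPoints P, ∀ b ∈ P ∪ crossingPoints P, a ≠ b → q ∉ line[ℝ, a, b]) :
    InGeneralPosition (insert q P) := by
  have hline : ∀ a ∈ P, ∀ b ∈ P, a ≠ b → ¬ Collinear ℝ ({q, a, b} : Set Plane) := by
    intro a ha b hb hab hcol
    exact hq a (Or.inl ha) b (Or.inl hb) hab
      (hcol.mem_affineSpan_of_mem_of_ne (by simp) (by simp) (by simp) hab)
  have hseg : ∀ e : Sym2 Plane, (∀ a ∈ e, a ∈ P) → ¬ e.IsDiag → q ∉ pairSegment e := by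
    intro e he hd h
    induction e with
    | h a b => exact hline a (he a (by simp)) b (he b (by simp)) (by simpa using hd)
                (collinear_of_mem_segment h)
  have hpair : ∀ e f : Sym2 Plane, (∀ a ∈ e, a ∈ Insert.insert q P) →
      (∀ a ∈ f, a ∈ Insert.insert q P) → ¬ e.IsDiag → ¬ f.IsDiag → e ≠ f → q ∈ e → q ∈ f →
      ∀ z, z ∈ pairSegment e → z ∈ pairSegment f → z = q := by
    intro e f he hf hde hdf hef hqe hqf z hze hzf
    obtain ⟨a, rfl⟩ := hqe
    obtain ⟨b, rfl⟩ := hqf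
    have haq : a ≠ q := fun h => hde (by simp [h])
    have hbq : b ≠ q := fun h => hdf (by simp [h])
    have ha : a ∈ P := (he a (by simp)).resolve_left haq
    have hb : b ∈ P := (hf b (by simp)).resolve_left hbq
    exact eq_of_mem_segments (hline a ha b hb fun h => hef (by rw [h])) hze hzf
  have hold : ∀ e : Sym2 Plane, (∀ a ∈ e, a ∈ Insert.insert q P) → q ∉ e → ∀ a ∈ e, a ∈ P := by
    intro e he hqe a ha
    exact (he a ha).resolve_left fun h => hqe (h ▸ ha)
  have hone : ∀ e f g : Sym2 Plane, (∀ a ∈ e, a ∈ Insert.insert q P) → (∀ a ∈ f, a ∈ P) →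
      (∀ a ∈ g, a ∈ P) → ¬ e.IsDiag → ¬ f.IsDiag → ¬ g.IsDiag → f ≠ g → q ∈ e →
      ∀ z, z ∈ pairSegment e → z ∈ pairSegment f → z ∈ pairSegment g →
      ∃ a, a ∈ e ∧ a ∈ f ∧ a ∈ g := by
    intro e f g he hf hg hde hdf hdg hfg hqe z hze hzf hzg
    obtain ⟨a, rfl⟩ := hqe
    have haq : a ≠ q := fun h => hde (by simp [h])
    have ha : a ∈ P := (he a (by simp)).resolve_left haq
    -- Otherwise `q` lies on the line through the crossing point `z` of `f` and `g` and the point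
    -- `a` of `P`, which `hq` excludes.
    have hza : z = a := by
      by_contra hza
      refine hq z (Or.inr ⟨f, g, hf, hg, hdf, hdg, hfg, hzf, hzg⟩) a (Or.inl ha) hza ?_
      exact (collinear_of_mem_segment hze).mem_affineSpan_of_mem_of_ne
        (by simp) (by simp) (by simp) hza
    subst hza
    exact ⟨z, by simp, hP.mem_of_mem_pairSegment hf hdf ha hzf,
      hP.mem_of_mem_pairSegment hg hdg ha hzg⟩
  constructor
  · intro a ha b hb c hc hab hac hbc
    rcases ha with rfl | ha
    · exact hline b (hb.resolve_left hab.symm) c (hc.resolve_left hac.symm) hbc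
    rcases hb with rfl | hb
    · intro h
      refine hline a ha c (hc.resolve_left hbc.symm) hac ?_
      rwa [Set.insert_comm]
    rcases hc with rfl | hc
    · intro h
      refine hline a ha b hb hab ?_
      convert h using 1
      ext; simp; tauto
    exact hP.not_collinear a ha b hb c hc hab hac hbc
  · rintro e₁ e₂ e₃ h₁ h₂ h₃ d₁ d₂ d₃ h₁₂ h₁₃ h₂₃ ⟨z, ⟨hz₁, hz₂⟩, hz₃⟩
    -- If exactly two segments end at `q`, they meet only in `q`, which is on no old segment. If
    -- exactly one does, `hone` applies.
    by_cases q₁ : q ∈ e₁ <;> by_cases q₂ : q ∈ e₂ <;> by_cases q₃ : q ∈ e₃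
    · exact ⟨q, q₁, q₂, q₃⟩
    · exact absurd (hpair _ _ h₁ h₂ d₁ d₂ h₁₂ q₁ q₂ z hz₁ hz₂ ▸ hz₃) (hseg _ (hold _ h₃ q₃) d₃)
    · exact absurd (hpair _ _ h₁ h₃ d₁ d₃ h₁₃ q₁ q₃ z hz₁ hz₃ ▸ hz₂) (hseg _ (hold _ h₂ q₂) d₂)
    · exact hone _ _ _ h₁ (hold _ h₂ q₂) (hold _ h₃ q₃) d₁ d₂ d₃ h₂₃ q₁ z hz₁ hz₂ hz₃
    · exact absurd (hpair _ _ h₂ h₃ d₂ d₃ h₂₃ q₂ q₃ z hz₂ hz₃ ▸ hz₁) (hseg _ (hold _ h₁ q₁) d₁)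
    · obtain ⟨a, h1, h2, h3⟩ :=
        hone _ _ _ h₂ (hold _ h₁ q₁) (hold _ h₃ q₃) d₂ d₁ d₃ h₁₃ q₂ z hz₂ hz₁ hz₃
      exact ⟨a, h2, h1, h3⟩
    · obtain ⟨a, h1, h2, h3⟩ :=
        hone _ _ _ h₃ (hold _ h₁ q₁) (hold _ h₂ q₂) d₃ d₁ d₂ h₁₂ q₃ z hz₃ hz₁ hz₂
      exact ⟨a, h2, h3, h1⟩
    · exact hP.not_concurrent e₁ e₂ e₃ (hold _ h₁ q₁) (hold _ h₂ q₂) (hold _ h₃ q₃) d₁ d₂ d₃ h₁₂ h₁₃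
        h₂₃ ⟨z, ⟨hz₁, hz₂⟩, hz₃⟩

/-- Arbitrarily close to any point there is a new point that can be added to a finite set in general
position. -/
theorem exists_insert (hP : InGeneralPosition P) (hfin : P.Finite) (x : Plane) {δ : ℝ}
    (hδ : 0 < δ) :
    ∃ q, dist q x < δ ∧ q ∉ P ∧ InGeneralPosition (Insert.insert q P) := by
  have hF := hfin.union (hP.finite_crossingPoints hfin)
  -- The degenerate pairs `(a, a)` are included on purpose: avoiding them makes `q` a new point.
  obtain ⟨q, hqx, hq⟩ := exists_dist_lt_forall_notMem_line
    ((P ∪ crossingPoints P) ×ˢ (P ∪ crossingPoints P)) (hF.prod hF) x hδ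
  exact ⟨q, hqx, fun hqP => hq (q, q) ⟨Or.inl hqP, Or.inl hqP⟩ (left_mem_affineSpan_pair _ _ _),
    hP.insert fun a ha b hb _ => hq (a, b) ⟨ha, hb⟩⟩

end InGeneralPosition

/-! ### Nested placement of rooted trees. -/

/-- The vertices of a finite rooted tree can be represented by points in general position so that
the segment between any two points outside the subtree rooted at `b` avoids the convex hull of
that subtree. Stated for a subset closed under taking ancestors. -/
theorem exists_nested_points_on {V : Type*} [PartialOrder V] [OrderBot V] [Finite V]
    (hchain : ∀ v a b : V, a ≤ v → b ≤ v → a ≤ b ∨ b ≤ a) (s : Finset V)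
    (hs : IsLowerSet (s : Set V)) :
    ∃ p : V → Plane, Set.InjOn p s ∧ InGeneralPosition (p '' s) ∧
      ∀ b v w : V, b ∈ s → v ∈ s → w ∈ s → ¬ b ≤ v → ¬ b ≤ w →
        Disjoint (segment ℝ (p v) (p w)) (convexHull ℝ (p '' (s ∩ Set.Ici b))) := by
  classical
  induction hn : s.card generalizing s with
  | zero =>
    obtain rfl := Finset.card_eq_zero.1 hn
    exact ⟨fun _ => 0, by simp, by simpa using InGeneralPosition.empty, by simp⟩
  | succ n ih =>
    obtain ⟨u, humax⟩ := s.exists_maximal (Finset.card_pos.1 (by omega))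
    have hu : u ∈ s := humax.1
    have hut : ∀ y ∈ s, u ≤ y → y = u := fun y hy h => le_antisymm (humax.2 hy h) h
    have hmem : ∀ y, y ∈ s.erase u ↔ y ≠ u ∧ y ∈ s := fun y => Finset.mem_erase
    have hst : (s : Set V) = insert u (s.erase u : Set V) := by
      rw [← Finset.coe_insert, Finset.insert_erase hu]
    have hlow : IsLowerSet (s.erase u : Set V) := by
      intro a b hba ha
      rw [Finset.mem_coe, hmem] at ha ⊢
      exact ⟨fun h => ha.1 (hut a ha.2 (h ▸ hba)), hs hba ha.2⟩
    obtain ⟨p, hpinj, hpgp, hpd⟩ := ih _ hlow (by rw [Finset.card_erase_of_mem hu, hn]; rfl)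
    have hfin : (p '' (s.erase u : Set V)).Finite := (Finset.finite_toSet _).image p
    -- `u` is a leaf of `s` and `x` its parent; there is none only if `u` is the root, and then `s`
    -- is just `u`.
    obtain ⟨x, hx⟩ : ∃ x : V, s.erase u = ∅ ∨ x ∈ s.erase u ∧ x < u ∧ ∀ y < u, y ≤ x := by
      by_cases hbot : u = ⊥
      · refine ⟨u, Or.inl ?_⟩
        ext y
        rw [hmem]
        simp only [Finset.notMem_empty, iff_false, not_and]
        exact fun h1 h2 => h1 (hut y h2 (hbot ▸ bot_le))
      · obtain ⟨x, hxmax⟩ := (Set.toFinite (Set.Iio u)).exists_maximal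
          ⟨⊥, bot_lt_iff_ne_bot.2 hbot⟩
        refine ⟨x, Or.inr ⟨(hmem x).2 ⟨hxmax.1.ne, hs hxmax.1.le hu⟩, hxmax.1, fun y hy => ?_⟩⟩
        rcases hchain u y x hy.le hxmax.1.le with h | h
        · exact h
        · exact hxmax.2 hy h
    -- Disjoint compact sets have disjoint thickenings, so one `δ` preserves all the finitely many
    -- disjointness conditions when points move by less than `δ`.
    have hev : ∀ᶠ δ in nhdsWithin (0 : ℝ) (Set.Ioi 0), ∀ b v w : V, b ∈ s.erase u → v ∈ s.erase u →
        w ∈ s.erase u → ¬ b ≤ v → ¬ b ≤ w →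
        Disjoint (Metric.thickening δ (segment ℝ (p v) (p w)))
          (Metric.thickening δ (convexHull ℝ (p '' ((s.erase u : Set V) ∩ Set.Ici b)))) := by
      simp only [Filter.eventually_all]
      intro b v w hb hv hw hbv hbw
      have hc1 : IsCompact (segment ℝ (p v) (p w)) := by
        rw [← convexHull_pair]
        exact (Set.toFinite _).isCompact_convexHull ℝ
      have hc2 : IsCompact (convexHull ℝ (p '' ((s.erase u : Set V) ∩ Set.Ici b))) :=
        (Set.toFinite _).isCompact_convexHull ℝ
      obtain ⟨ε, hε, hd⟩ := (hpd b v w hb hv hw hbv hbw).exists_thickenings hc1 hc2.isClosed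
      filter_upwards [Ioo_mem_nhdsGT hε] with δ hδ
      exact hd.mono (Metric.thickening_mono hδ.2.le _) (Metric.thickening_mono hδ.2.le _)
    obtain ⟨δ, hδ, hδ0⟩ := (hev.and self_mem_nhdsWithin).exists
    obtain ⟨q, hqx, hqP, hqgp⟩ := hpgp.exists_insert hfin (p x) hδ0
    have hp' : ∀ y, y ≠ u → Function.update p u q y = p y :=
      fun y hy => Function.update_of_ne hy _ _
    have himg : Function.update p u q '' s = insert q (p '' (s.erase u : Set V)) := by
      rw [hst, Set.image_insert_eq, Function.update_self]
      congr 1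
      exact Set.image_congr fun y hy => hp' y ((hmem y).1 hy).1
    refine ⟨Function.update p u q, ?_, himg ▸ hqgp, ?_⟩
    · rw [hst, Set.injOn_insert (by simp)]
      have heq : Set.EqOn (Function.update p u q) p (s.erase u : Set V) :=
        fun y hy => hp' y ((hmem y).1 hy).1
      exact ⟨hpinj.congr heq.symm, by rwa [Function.update_self, heq.image_eq]⟩
    intro b v w hb hv hw hbv hbw
    by_cases hbu : b = u
    · subst hbu
      have hvb : v ≠ b := fun h => hbv h.ge
      have hwb : w ≠ b := fun h => hbw h.ge
      have hsing : (s : Set V) ∩ Set.Ici b = {b} := by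
        ext y
        simp only [Set.mem_inter_iff, Finset.mem_coe, Set.mem_Ici, Set.mem_singleton_iff]
        exact ⟨fun h => hut y h.1 h.2, by rintro rfl; exact ⟨hb, le_rfl⟩⟩
      rw [hsing, Set.image_singleton, convexHull_singleton, Function.update_self, hp' v hvb,
        hp' w hwb, Set.disjoint_singleton_right]
      intro hq
      have hvP : p v ∈ p '' (s.erase b : Set V) := ⟨v, (hmem v).2 ⟨hvb, hv⟩, rfl⟩
      have hwP : p w ∈ p '' (s.erase b : Set V) := ⟨w, (hmem w).2 ⟨hwb, hw⟩, rfl⟩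
      by_cases hvw : p v = p w
      · rw [hvw, segment_same] at hq
        exact hqP (hq ▸ hwP)
      · exact hqgp.not_collinear q (by simp) (p v) (Or.inr hvP) (p w) (Or.inr hwP)
          (fun h => hqP (h ▸ hvP)) (fun h => hqP (h ▸ hwP)) hvw (collinear_of_mem_segment hq)
    have hbt : b ∈ s.erase u := (hmem b).2 ⟨hbu, hb⟩
    obtain ⟨hxt, hxu, hxmax⟩ := hx.resolve_left (Finset.ne_empty_of_mem hbt)
    -- For `b ≠ u`, the leaf `u` is in the subtree of `b` exactly when its parent is, so `x` can
    -- stand in for `u`.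
    have hclose : ∀ y ∈ s, ∃ y' ∈ s.erase u, (b ≤ y ↔ b ≤ y') ∧
        dist (Function.update p u q y) (p y') < δ := by
      intro y hy
      by_cases hyu : y = u
      · refine ⟨x, hxt, ?_, by rwa [hyu, Function.update_self]⟩
        exact ⟨fun h => hxmax b (lt_of_le_of_ne (hyu ▸ h) hbu), fun h => hyu ▸ h.trans hxu.le⟩
      · exact ⟨y, (hmem y).2 ⟨hyu, hy⟩, Iff.rfl, by rw [hp' y hyu, dist_self]; exact hδ0⟩
    obtain ⟨v', hv', hbv', hdv⟩ := hclose v hv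
    obtain ⟨w', hw', hbw', hdw⟩ := hclose w hw
    refine (hδ b v' w' hbt hv' hw' (fun h => hbv (hbv'.2 h)) (fun h => hbw (hbw'.2 h))).mono ?_ ?_
    · exact ((convex_segment _ _).thickening δ).segment_subset
        (Metric.mem_thickening_iff.2 ⟨_, left_mem_segment _ _ _, hdv⟩)
        (Metric.mem_thickening_iff.2 ⟨_, right_mem_segment _ _ _, hdw⟩)
    · refine convexHull_min ?_ ((convex_convexHull _ _).thickening δ)
      rintro _ ⟨y, ⟨hy, hby⟩, rfl⟩
      obtain ⟨y', hy', hbyy', hd⟩ := hclose y hy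
      exact Metric.mem_thickening_iff.2
        ⟨_, subset_convexHull ℝ _ ⟨y', ⟨hy', hbyy'.1 hby⟩, rfl⟩, hd⟩

/-- The vertices of a finite rooted forest can be represented by points in general position so that
the segment between any two points outside the subtree rooted at `b` avoids the segment between any
two points of that subtree. -/
theorem exists_nested_points {V : Type*} [PartialOrder V] [Finite V]
    (hchain : ∀ v a b : V, a ≤ v → b ≤ v → a ≤ b ∨ b ≤ a) :
    ∃ p : V → Plane, Function.Injective p ∧ InGeneralPosition (Set.range p) ∧
      ∀ b v w x y : V, ¬ b ≤ v → ¬ b ≤ w → b ≤ x → b ≤ y →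
        Disjoint (segment ℝ (p v) (p w)) (segment ℝ (p x) (p y)) := by
  classical
  cases nonempty_fintype V
  -- A new bottom element joins the trees of the forest under one root.
  have hchain' : ∀ v a b : WithBot V, a ≤ v → b ≤ v → a ≤ b ∨ b ≤ a := by
    intro v a b ha hb
    induction a with
    | bot => simp
    | coe a =>
    induction b with
    | bot => simp
    | coe b =>
    induction v with
    | bot => simp at ha
    | coe v =>
    simp only [WithBot.coe_le_coe] at *
    exact hchain v a b ha hb
  have : Fintype (WithBot V) := inferInstanceAs (Fintype (Option V))
  obtain ⟨p, hinj, hgp, hd⟩ := exists_nested_points_on hchain' Finset.univ (by simp [isLowerSet_univ])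
  rw [Finset.coe_univ] at hinj hgp hd
  refine ⟨fun v => p v, fun a b h => WithBot.coe_injective (hinj (by simp) (by simp) h),
    hgp.mono ?_, ?_⟩
  · rintro _ ⟨v, rfl⟩
    exact ⟨v, by simp, rfl⟩
  · intro b v w x y hbv hbw hbx hby
    refine (hd b v w (by simp) (by simp) (by simp) (by simpa) (by simpa)).mono_right ?_
    refine (convex_convexHull ℝ _).segment_subset (subset_convexHull ℝ _ ⟨x, by simpa, rfl⟩)
      (subset_convexHull ℝ _ ⟨y, by simpa, rfl⟩)

/-! ### Ancestor orders of rooted trees and of tree decompositions. -/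

namespace SimpleGraph

/-- `T.Dominates r x y`: the vertex `x` lies on every walk from `r` to `y`. In a tree with root `r`,
this says that `x` is an ancestor of `y` or `y` itself. -/
def Dominates {W : Type*} (T : SimpleGraph W) (r x y : W) : Prop :=
  ∀ p : T.Walk r y, x ∈ p.support

namespace Dominates

variable {W : Type*} {T : SimpleGraph W} {r x y z : W}

theorem refl (x : W) : T.Dominates r x x := fun p => p.end_mem_support

theorem trans (h₁ : T.Dominates r x y) (h₂ : T.Dominates r y z) : T.Dominates r x z := by
  classical
  exact fun p => p.support_takeUntil_subset_support (h₂ p) (h₁ (p.takeUntil y (h₂ p)))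

/-- A shortest walk to `x` passes through `y`, and its part up to `y` already passes through `x`. -/
theorem antisymm (hT : T.Connected) (h₁ : T.Dominates r x y) (h₂ : T.Dominates r y x) : x = y := by
  classical
  by_contra hxy
  obtain ⟨p, hp⟩ := hT.exists_walk_length_eq_dist r x
  have h3 := h₁ (p.takeUntil y (h₂ p))
  have h4 := dist_le ((p.takeUntil y (h₂ p)).takeUntil x h3)
  have h5 := Walk.length_takeUntil_lt_length (h₂ p) (Ne.symm hxy)
  have h6 := Walk.length_takeUntil_lt_length h3 hxy
  omega

/-- Otherwise some walk reaches `y` without `x` and some walk reaches `x` without `y`. Continuing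
one of them along a path from `r` to `z` avoids `x` or `y`, depending on whether `y` occurs on that
path after `x`. -/
theorem total (hT : T.Connected) (h₁ : T.Dominates r x z) (h₂ : T.Dominates r y z) :
    T.Dominates r x y ∨ T.Dominates r y x := by
  classical
  by_cases hxy : x = y
  · exact Or.inl (hxy ▸ refl x)
  by_contra! hcon
  simp only [Dominates, not_forall] at hcon
  obtain ⟨⟨p, hp⟩, q, hq⟩ := hcon
  obtain ⟨w, hw⟩ := (hT.preconnected r z).exists_isPath
  by_cases hy : y ∈ (w.dropUntil x (h₁ w)).support
  · have h3 := h₁ (p.append ((w.dropUntil x (h₁ w)).dropUntil y hy))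
    rw [Walk.mem_support_append_iff] at h3
    have h4 := hw.dropUntil (h₁ w)
    rw [← Walk.take_spec (w.dropUntil x (h₁ w)) hy] at h4
    rcases h3 with h3 | h3
    · exact hp h3
    · exact h4.ne_of_mem_support_of_append hxy (Walk.start_mem_support _) h3 rfl
  · have h3 := h₂ (q.append (w.dropUntil x (h₁ w)))
    rw [Walk.mem_support_append_iff] at h3
    exact h3.elim hq hy

theorem exists_isPath_subset {S : Set W} (hS : (T.induce S).Connected) (hx : x ∈ S) (hz : z ∈ S) :
    ∃ p : T.Walk x z, p.IsPath ∧ ∀ y ∈ p.support, y ∈ S := by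
  obtain ⟨q, hq⟩ := (hS.preconnected ⟨x, hx⟩ ⟨z, hz⟩).exists_isPath
  let f : T.induce S →g T := (Embedding.induce S).toHom
  refine ⟨(q.map f : T.Walk x z), hq.map Subtype.val_injective, ?_⟩
  intro y hy
  have hy' : y ∈ (q.map f).support := hy
  rw [Walk.support_map, List.mem_map] at hy'
  obtain ⟨a, _, rfl⟩ := hy'
  exact a.2

/-- If `y` were outside `S`, a walk to `x` avoiding `y`, continued inside `S` to `z`, would avoid
`y`. -/
theorem mem_of_connected (hT : T.Connected) {S : Set W} (hS : (T.induce S).Connected)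
    (hx : x ∈ S) (hz : z ∈ S) (h₁ : T.Dominates r x y) (h₂ : T.Dominates r y z) : y ∈ S := by
  by_contra hy
  have hyx : ¬ T.Dominates r y x := fun h => hy (antisymm hT h₁ h ▸ hx)
  simp only [Dominates, not_forall] at hyx
  obtain ⟨p, hp⟩ := hyx
  obtain ⟨q, -, hq⟩ := exists_isPath_subset hS hx hz
  have h3 := h₂ (p.append q)
  rw [Walk.mem_support_append_iff] at h3
  exact h3.elim hp fun h => hy (hq _ h)

/-- Let `t` be the element of `S` nearest to `r`. A shortest path to `t` meets `S` only in `t`, so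
extending it by a path inside `S` gives the unique path from `r` to `x`. -/
theorem exists_of_connected (hT : T.IsTree) (r : W) {S : Set W} (hS : (T.induce S).Connected) :
    ∃ t ∈ S, ∀ x ∈ S, T.Dominates r t x := by
  classical
  obtain ⟨t, ht, hmin⟩ : ∃ t ∈ S, ∀ x ∈ S, T.dist r t ≤ T.dist r x := by
    obtain ⟨s⟩ := hS.nonempty
    have hne : S.Nonempty := ⟨s, s.2⟩
    exact ⟨_, Function.argminOn_mem (T.dist r) S hne,
      fun x hx => Function.argminOn_le (T.dist r) S hx⟩
  refine ⟨t, ht, fun x hx p => ?_⟩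
  obtain ⟨q, hq, hql⟩ := hT.connected.exists_path_of_dist r t
  obtain ⟨s, hs, hsS⟩ := exists_isPath_subset hS ht hx
  have hpath : (q.append s).IsPath := by
    rw [Walk.isPath_def, Walk.support_append, List.nodup_append]
    refine ⟨hq.support_nodup, hs.support_nodup.tail, fun a ha b hb hab => ?_⟩
    subst hab
    have h1 : a ≠ t := by
      rintro rfl
      have := hs.support_nodup
      rw [← Walk.cons_tail_support, List.nodup_cons] at this
      exact this.1 hb
    have h2 := hmin a (hsS a (List.mem_of_mem_tail hb))
    have h3 := Walk.length_takeUntil_lt_length ha h1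
    have h4 := dist_le (q.takeUntil a ha)
    omega
  have heq : q.append s = p.bypass := congrArg Subtype.val
    ((hT.isAcyclic.subsingleton_path r x).elim ⟨_, hpath⟩ ⟨_, p.bypass_isPath⟩)
  refine p.support_bypass_subset_support ?_
  rw [← heq]
  simp

end Dominates

/-- The ancestor order of a tree with a chosen root. -/
theorem IsTree.exists_partialOrder {W : Type*} {T : SimpleGraph W} (hT : T.IsTree) :
    ∃ _ : PartialOrder W, (∀ x y z : W, x ≤ z → y ≤ z → x ≤ y ∨ y ≤ x) ∧
      ∀ S : Set W, (T.induce S).Connected → (∃ t ∈ S, ∀ x ∈ S, t ≤ x) ∧ S.OrdConnected := by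
  obtain ⟨r⟩ := hT.connected.nonempty
  let o : PartialOrder W :=
    { le := T.Dominates r, le_refl := Dominates.refl, le_trans := fun _ _ _ => Dominates.trans,
      le_antisymm := fun _ _ => Dominates.antisymm hT.connected }
  exact ⟨o, fun _ _ _ => Dominates.total hT.connected, fun S hS =>
    ⟨Dominates.exists_of_connected hT r hS,
      ⟨fun x hx z hz y hy => Dominates.mem_of_connected hT.connected hS hx hz hy.1 hy.2⟩⟩⟩

/-- A tree decomposition yields a forest order on the vertices and, for every vertex `v`, a set of
at most `D.width` vertices that contains all smaller neighbours of `v`. -/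
theorem Decomposition.exists_partialOrder {V W : Type*} [Fintype V] [Fintype W]
    {G : SimpleGraph V} {T : SimpleGraph W} (D : G.Decomposition T) (hT : T.IsTree) :
    ∃ (_ : PartialOrder V) (B : V → Finset V), (∀ v a b : V, a ≤ v → b ≤ v → a ≤ b ∨ b ≤ a) ∧
      (∀ v, (B v).card ≤ D.width) ∧ (∀ v w, G.Adj v w → w < v ∧ w ∈ B v ∨ v < w ∧ v ∈ B w) ∧
      ∀ v w b, w ∈ B v → w < b → b ≤ v → w ∈ B b := by
  classical
  obtain ⟨_, hchain, hconn⟩ := hT.exists_partialOrder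
  choose t htmem ht using fun v => (hconn _ (D.connected_bags v)).1
  have hord := fun v => (hconn _ (D.connected_bags v)).2
  -- `t v` is the top node of `v`; the enumeration turns the vertices sharing a top node into a
  -- chain.
  let f : V → W ×ₗ Fin (Fintype.card V) := fun v => toLex (t v, Fintype.equivFin V v)
  have hf : Function.Injective f := fun a b h =>
    (Fintype.equivFin V).injective (congrArg (fun x => (ofLex x).2) h)
  let o : PartialOrder V := PartialOrder.lift f hf
  have hle : ∀ a b : V, a ≤ b ↔ t a < t b ∨ t a = t b ∧ Fintype.equivFin V a ≤ Fintype.equivFin V b :=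
    fun a b => Prod.Lex.toLex_le_toLex
  have hle' : ∀ a b : V, a ≤ b → t a ≤ t b := fun a b h =>
    ((hle a b).1 h).elim le_of_lt fun h => h.1.le
  have htot : ∀ a b : V, t a ≤ t b → a ≤ b ∨ b ≤ a := by
    intro a b h
    rcases h.lt_or_eq with h | h
    · exact Or.inl ((hle a b).2 (Or.inl h))
    · exact (le_total (Fintype.equivFin V a) (Fintype.equivFin V b)).imp
        (fun h' => (hle a b).2 (Or.inr ⟨h, h'⟩)) fun h' => (hle b a).2 (Or.inr ⟨h.symm, h'⟩)
  have hadj : ∀ v w x, v ∈ D.bag x → w ∈ D.bag x → w < v → w ∈ (D.bag (t v)).erase v := by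
    intro v w x hv hw hwv
    -- The node `t v` lies between `t w` and `x`, whose bags both contain `w`.
    exact Finset.mem_erase.2 ⟨hwv.ne, (hord w).out (htmem w) hw ⟨hle' w v hwv.le, ht v x hv⟩⟩
  refine ⟨o, fun v => (D.bag (t v)).erase v, ?_, ?_, ?_, ?_⟩
  · intro v a b ha hb
    exact (hchain _ _ _ (hle' a v ha) (hle' b v hb)).elim (htot a b) fun h => (htot b a h).symm
  · intro v
    rw [Finset.card_erase_of_mem (htmem v)]
    exact Nat.sub_le_sub_right
      (Finset.le_sup (f := fun x => (D.bag x).card) (Finset.mem_univ (t v))) 1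
  · intro v w hvw
    obtain ⟨x, hvx, hwx⟩ := D.exists_bag_of_adj v w hvw
    have hcomp : v ≤ w ∨ w ≤ v := (hchain _ _ _ (ht v x hvx) (ht w x hwx)).elim (htot v w)
      fun h => (htot w v h).symm
    rcases hcomp with h | h
    · have := lt_of_le_of_ne h hvw.ne
      exact Or.inr ⟨this, hadj w v x hwx hvx this⟩
    · have := lt_of_le_of_ne h hvw.ne'
      exact Or.inl ⟨this, hadj v w x hvx hwx this⟩
  · intro v w b hw hwb hbv
    exact Finset.mem_erase.2 ⟨hwb.ne, (hord w).out (htmem w) (Finset.mem_of_mem_erase hw)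
      ⟨hle' w b hwb.le, hle' b v hbv⟩⟩

end SimpleGraph

/-! ### The upper bound. -/

namespace SimpleGraph

variable {V : Type*} [Fintype V] {G : SimpleGraph V} [DecidableRel G.Adj]

/-- A graph of treewidth at most `k` has at most `k` edges per vertex. -/
theorem card_edgeFinset_le_of_treewidth_le {k : ℕ} (hk : G.treewidth ≤ k) :
    G.edgeFinset.card ≤ k * Fintype.card V := by
  classical
  obtain ⟨n, T, D, hT, hD⟩ := G.exists_decomposition_width_eq_treewidth
  obtain ⟨_, B, -, hB, hadj, -⟩ := D.exists_partialOrder hT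
  have hsub : G.edgeFinset ⊆ Finset.univ.biUnion fun v => (B v).image fun w => s(v, w) := by
    intro e he
    induction e with
    | h v w =>
      simp only [Finset.mem_biUnion, Finset.mem_univ, true_and, Finset.mem_image]
      rcases hadj v w (by simpa using he) with h | h
      · exact ⟨v, w, h.2, rfl⟩
      · exact ⟨w, v, h.2, Sym2.eq_swap⟩
  refine (Finset.card_le_card hsub).trans ?_
  rw [mul_comm, ← Finset.card_univ]
  exact Finset.card_biUnion_le_card_mul _ _ _ fun v _ =>
    Finset.card_image_le.trans ((hB v).trans (hD.le.trans hk))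

/-- A graph of treewidth at most `k` has a rectilinear drawing with at most `k` times its maximum
degree times its number of edges crossings. -/
theorem rectilinearCrossingNumber_le_of_treewidth_le {k : ℕ} (hk : G.treewidth ≤ k) :
    G.rectilinearCrossingNumber ≤ ((k * G.maxDegree * G.edgeFinset.card : ℕ) : ℕ∞) := by
  classical
  obtain ⟨n, T, D, hT, hD⟩ := G.exists_decomposition_width_eq_treewidth
  obtain ⟨_, B, hchain, hB, hadj, hB'⟩ := D.exists_partialOrder hT
  obtain ⟨p, hinj, hgp, hdisj⟩ := exists_nested_points hchain
  let R : G.RectilinearDrawing := ⟨p, hinj, hgp⟩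
  refine (iInf_le _ R).trans ?_
  -- `g e` is the lower end of an edge `e`, and arbitrary on non-edges.
  have hlow : ∀ e : Sym2 V, ∃ b, e ∈ G.edgeSet → ∃ a, e = s(a, b) ∧ b < a ∧ b ∈ B a := by
    intro e
    induction e with
    | h v w =>
      by_cases h : G.Adj v w
      · rcases hadj v w h with h | h
        · exact ⟨w, fun _ => ⟨v, rfl, h⟩⟩
        · exact ⟨v, fun _ => ⟨w, Sym2.eq_swap, h⟩⟩
      · exact ⟨v, fun h' => absurd h' h⟩
  choose g hg using hlow
  -- The candidate crossings charged to `e`: pairs of `e` with an edge having an end in `B (g e)`.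
  let X : Finset (Sym2 (Sym2 V)) := G.edgeFinset.biUnion fun e => (B (g e)).biUnion fun w =>
    (G.neighborFinset w).image fun v => s(e, s(v, w))
  have hX : X.card ≤ k * G.maxDegree * G.edgeFinset.card := by
    rw [mul_comm]
    refine Finset.card_biUnion_le_card_mul _ _ _ fun e _ => ?_
    refine (Finset.card_biUnion_le_card_mul _ _ G.maxDegree fun w _ => ?_).trans
      (Nat.mul_le_mul_right _ ((hB _).trans (hD.le.trans hk)))
    exact Finset.card_image_le.trans (G.degree_le_maxDegree w)
  have hmem : ∀ v w a b : V, G.Adj v w → G.Adj a b → g s(a, b) = b → w ∈ B v → w < b → b ≤ v →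
      s(s(a, b), s(v, w)) ∈ X := by
    intro v w a b hvw hab hgb hw hwb hbv
    simp only [X, Finset.mem_biUnion, Finset.mem_image, mem_edgeFinset, mem_neighborFinset]
    exact ⟨s(a, b), hab, w, by rw [hgb]; exact hB' v w b hw hwb hbv, v, hvw.symm, rfl⟩
  have hsub : R.crossingPairs ⊆ X := by
    rintro _ ⟨e, f, rfl, he, hf, hef, hne⟩
    obtain ⟨v, hev, hwv, hwB⟩ := hg e he
    obtain ⟨a, hfa, hba, hbB⟩ := hg f hf
    have hge : g s(v, g e) = g e := by rw [← hev]
    have hgf : g s(a, g f) = g f := by rw [← hfa]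
    generalize g e = w at *
    generalize g f = b at *
    subst hev hfa
    have hne' : (segment ℝ (p v) (p w) ∩ segment ℝ (p a) (p b)).Nonempty := hne
    -- Otherwise `vw` lies entirely outside the subtree of `b`, which contains `ab`.
    have hbv : b ≤ v := by
      by_contra h
      exact Set.not_disjoint_iff_nonempty_inter.2 hne'
        (hdisj b v w a b h (fun h' => h (h'.trans hwv.le)) hba.le le_rfl)
    have hwa : w ≤ a := by
      by_contra h
      rw [Set.inter_comm] at hne'
      exact Set.not_disjoint_iff_nonempty_inter.2 hne'
        (hdisj w a b v w h (fun h' => h (h'.trans hba.le)) hwv.le le_rfl)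
    have hwb : w ≠ b := by
      rintro rfl
      exact hef w ⟨by simp, by simp⟩
    rcases hchain v w b hwv.le hbv with h | h
    · rw [Sym2.eq_swap]
      exact hmem v w a b he hf hgf hwB (lt_of_le_of_ne h hwb) hbv
    · exact hmem a b v w hf he hge hbB (lt_of_le_of_ne h hwb.symm) hwa
  calc R.crossings ≤ (X : Set (Sym2 (Sym2 V))).encard := Set.encard_le_encard hsub
    _ = (X.card : ℕ∞) := Set.encard_coe_eq_coe_finsetCard X
    _ ≤ _ := by exact_mod_cast hX

end SimpleGraph

/-! ### Signs of barycentric coordinates. -/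

section SignPatterns

variable {x y z x' y' z' l m n : ℝ}

theorem false_of_mul_neg (h₁ : m * n < 0) (h₂ : l * n < 0) (h₃ : l * m < 0) : False := by
  nlinarith [mul_pos_of_neg_of_neg h₁ h₂, sq_nonneg n, mul_pos_of_neg_of_neg h₂ h₃]

/-- Here `m` and `n` have equal signs, opposite to that of `l`, so each relation forces its first
two coefficients to agree in sign. But only `x` changes sign. -/
theorem false_of_one_sign_change (e : x * l + y * m + z * n = 0)
    (e' : x' * l + y' * m + z' * n = 0) (hx : x * x' < 0) (hy : 0 < y * y') (hz : 0 < z * z')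
    (hyz : 0 < y * z) (hm : l * n < 0) (hn : l * m < 0) : False := by
  have hmn : 0 < m * n := by
    by_contra! h
    nlinarith [mul_pos_of_neg_of_neg hm hn, mul_nonneg_of_nonpos_of_nonpos h h, sq_nonneg l]
  have hyz' : 0 < y' * z' := by
    have : 0 < (y * z) * (y' * z') := by nlinarith [mul_pos hy hz]
    exact pos_of_mul_pos_right this hyz.le
  have key : ∀ a b c : ℝ, a * l + b * m + c * n = 0 → 0 < b * c → 0 ≤ a * b := by
    intro a b c h hbc
    by_contra! hab
    have h1 := mul_pos_of_neg_of_neg hab hn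
    have h2 := mul_pos hbc hmn
    have h3 : b * m * (a * l + b * m + c * n) = 0 := by rw [h, mul_zero]
    nlinarith [sq_nonneg (b * m)]
  have h1 := key x y z e hyz
  have h2 := key x' y' z' e' hyz'
  nlinarith [mul_nonneg h1 h2, mul_neg_of_neg_of_pos hx hy]

/-- In each relation the first two terms have equal signs, so the third has the opposite sign: `x *
z` and `x' * z'` agree in sign, although `x` changes and `z` does not. -/
theorem false_of_two_sign_changes (e : x * l + y * m + z * n = 0)
    (e' : x' * l + y' * m + z' * n = 0) (hx : x * x' < 0) (hy : y * y' < 0) (hz : 0 < z * z')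
    (hxy : x * y < 0) (hn : l * m < 0) : False := by
  have hxy' : x' * y' < 0 := by
    have : 0 < (x * y) * (x' * y') := by nlinarith [mul_pos_of_neg_of_neg hx hy]
    by_contra! h
    nlinarith [mul_nonneg h (neg_nonneg.2 hxy.le)]
  have key : ∀ a b c : ℝ, a * l + b * m + c * n = 0 → a * b < 0 → a * c * (l * n) < 0 := by
    intro a b c h hab
    have h1 := mul_pos_of_neg_of_neg hab hn
    have h3 : a * l * (a * l + b * m + c * n) = 0 := by rw [h, mul_zero]
    nlinarith [sq_nonneg (a * l)]
  have h1 := mul_pos_of_neg_of_neg (key x y z e hxy) (key x' y' z' e' hxy')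
  nlinarith [mul_nonneg (mul_pos (neg_pos.2 hx) hz).le (sq_nonneg (l * n))]

/-- At least two of the three numbers are negative. -/
def TwoNeg (x y z : ℝ) : Prop := x < 0 ∧ y < 0 ∨ x < 0 ∧ z < 0 ∨ y < 0 ∧ z < 0

/-- The differences are the entries of the cross product of the coordinate vectors, hence orthogonal
to both. If the claim fails, every coordinate of unchanged sign has the other two entries of
opposite signs. The class condition and the coordinate sums leave only the sign patterns refuted
above. -/
theorem exists_agreeing_sign (hx : x ≠ 0) (hy : y ≠ 0) (hz : z ≠ 0) (hx' : x' ≠ 0) (hy' : y' ≠ 0)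
    (hz' : z' ≠ 0) (hs : x + y + z = 1) (hs' : x' + y' + z' = 1)
    (hneg : TwoNeg x y z ↔ TwoNeg x' y' z') :
    0 < x * x' ∧ 0 ≤ (z * x' - x * z') * (x * y' - y * x') ∨
    0 < y * y' ∧ 0 ≤ (y * z' - z * y') * (x * y' - y * x') ∨
    0 < z * z' ∧ 0 ≤ (y * z' - z * y') * (z * x' - x * z') := by
  by_contra! hcon
  obtain ⟨h1, h2, h3⟩ := hcon
  have e : x * (y * z' - z * y') + y * (z * x' - x * z') + z * (x * y' - y * x') = 0 := by ring
  have e' : x' * (y * z' - z * y') + y' * (z * x' - x * z') + z' * (x * y' - y * x') = 0 := by ring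
  generalize y * z' - z * y' = l at *
  generalize z * x' - x * z' = m at *
  generalize x * y' - y * x' = n at *
  have hpos : ∀ {a b : ℝ}, a ≠ 0 → b ≠ 0 → (0 < a * b ↔ (a < 0 ↔ b < 0)) := by
    intro a b ha hb
    rcases ha.lt_or_gt with ha | ha <;> rcases hb.lt_or_gt with hb | hb <;>
      simp [mul_pos_iff, ha, hb, ha.not_gt, hb.not_gt]
  have hlt : ∀ {a b : ℝ}, a ≠ 0 → b ≠ 0 → (a * b < 0 ↔ ¬ (a < 0 ↔ b < 0)) := by
    intro a b ha hb
    rw [← hpos ha hb, not_lt]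
    exact ⟨le_of_lt, fun h => lt_of_le_of_ne h (mul_ne_zero ha hb)⟩
  have k0 := fun (a : 0 < x * x') (b : 0 < y * y') (c : 0 < z * z') =>
    false_of_mul_neg (h1 a) (h2 b) (h3 c)
  have kx := fun (a : x * x' < 0) (b : 0 < y * y') (c : 0 < z * z') (d : 0 < y * z) =>
    false_of_one_sign_change e e' a b c d (h2 b) (h3 c)
  have ky := fun (a : y * y' < 0) (b : 0 < x * x') (c : 0 < z * z') (d : 0 < x * z) =>
    false_of_one_sign_change (l := m) (m := l) (by linarith) (by linarith) a b c d (h1 b)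
      (mul_comm l m ▸ h3 c)
  have kz := fun (a : z * z' < 0) (b : 0 < x * x') (c : 0 < y * y') (d : 0 < x * y) =>
    false_of_one_sign_change (l := n) (m := l) (n := m) (by linarith) (by linarith) a b c d
      (mul_comm m n ▸ h1 b) (mul_comm l n ▸ h2 c)
  have jx := fun (a : y * y' < 0) (b : z * z' < 0) (c : 0 < x * x') (d : y * z < 0) =>
    false_of_two_sign_changes (l := m) (m := n) (n := l) (by linarith) (by linarith) a b c d (h1 c)
  have jy := fun (a : x * x' < 0) (b : z * z' < 0) (c : 0 < y * y') (d : x * z < 0) =>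
    false_of_two_sign_changes (l := l) (m := n) (n := m) (by linarith) (by linarith) a b c d (h2 c)
  have jz := fun (a : x * x' < 0) (b : y * y' < 0) (c : 0 < z * z') (d : x * y < 0) =>
    false_of_two_sign_changes e e' a b c d (h3 c)
  have hn : ¬ (x < 0 ∧ y < 0 ∧ z < 0) := fun h => by linarith [h.1, h.2.1, h.2.2]
  have hn' : ¬ (x' < 0 ∧ y' < 0 ∧ z' < 0) := fun h => by linarith [h.1, h.2.1, h.2.2]
  clear h1 h2 h3 e e' hs hs'
  rw [hpos hx hx', hpos hy hy', hpos hz hz'] at k0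
  rw [hlt hx hx', hpos hy hy', hpos hz hz', hpos hy hz] at kx
  rw [hpos hx hx', hlt hy hy', hpos hz hz', hpos hx hz] at ky
  rw [hpos hx hx', hpos hy hy', hlt hz hz', hpos hx hy] at kz
  rw [hpos hx hx', hlt hy hy', hlt hz hz', hlt hy hz] at jx
  rw [hlt hx hx', hpos hy hy', hlt hz hz', hlt hx hz] at jy
  rw [hlt hx hx', hlt hy hy', hpos hz hz', hlt hx hy] at jz
  unfold TwoNeg at hneg
  clear hpos hlt hx hy hz hx' hy' hz'
  generalize (x < 0) = p, (y < 0) = q, (z < 0) = r, (x' < 0) = p', (y' < 0) = q', (z' < 0) = r' at *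
  revert hneg k0 kx ky kz jx jy jz hn hn'
  rcases Classical.propComplete p with rfl | rfl <;>
  rcases Classical.propComplete q with rfl | rfl <;>
  rcases Classical.propComplete r with rfl | rfl <;>
  rcases Classical.propComplete p' with rfl | rfl <;>
  rcases Classical.propComplete q' with rfl | rfl <;>
  rcases Classical.propComplete r' with rfl | rfl <;> simp

end SignPatterns

/-! ### Forced crossings at a triangle. -/

/-- The segments from two vertices of a triangle to points `b` and `b'` meet if the barycentric
coordinates of `b` and `b'` satisfy suitable inequalities. -/
theorem segments_inter_nonempty {a₁ a₂ a₃ b b' : Plane} {x y z x' y' z' : ℝ}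
    (hb : b = x • a₁ + y • a₂ + z • a₃) (hb' : b' = x' • a₁ + y' • a₂ + z' • a₃)
    (hs : x + y + z = 1) (hs' : x' + y' + z' = 1) (hz : 0 < z * z')
    (h₁ : 0 ≤ z * (z * x' - x * z')) (h₂ : 0 ≤ z * (y * z' - z * y')) :
    (segment ℝ a₁ b ∩ segment ℝ a₂ b').Nonempty := by
  have hz2 : 0 < z * z := by
    have : z ≠ 0 := by rintro rfl; simp at hz
    exact mul_self_pos.2 this
  have htot : z * z' + z * (z * x' - x * z') = z * z + z * (y * z' - z * y') := by
    have e1 : x = 1 - y - z := by linarith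
    have e2 : x' = 1 - y' - z' := by linarith
    rw [e1, e2]; ring
  have hr : 0 < z * z' + z * (z * x' - x * z') := add_pos_of_pos_of_nonneg hz h₁
  -- This eliminates `a₃` from the two representations. The extra factor `z` makes all four weights
  -- nonnegative; dividing by their common total gives the intersection point.
  have hcomb : (z * (y * z' - z * y')) • a₂ + (z * z) • b' =
      (z * (z * x' - x * z')) • a₁ + (z * z') • b := by
    rw [hb, hb']; module
  have hz2' := hz2.le
  have hz' := hz.le
  generalize z * z = v at *
  generalize z * (z * x' - x * z') = s at *
  generalize z * (y * z' - z * y') = t at *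
  generalize z * z' = u at *
  refine ⟨(s / (u + s)) • a₁ + (u / (u + s)) • b,
    ⟨s / (u + s), u / (u + s), by positivity, by positivity, ?_, rfl⟩,
    ⟨t / (u + s), v / (u + s), by positivity, by positivity, ?_, ?_⟩⟩
  · rw [← add_div, add_comm s, div_self hr.ne']
  · rw [← add_div, add_comm t, ← htot, div_self hr.ne']
  · simp only [div_eq_inv_mul, mul_smul _ _ (_ : Plane), ← smul_add]
    rw [hcomb]

/-- Barycentric coordinates with respect to a triangle in the plane. -/
theorem exists_barycentric {a₁ a₂ a₃ : Plane} (h : ¬ Collinear ℝ ({a₁, a₂, a₃} : Set Plane))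
    (b : Plane) : ∃ x y z : ℝ, x + y + z = 1 ∧ b = x • a₁ + y • a₂ + z • a₃ := by
  have hind := affineIndependent_iff_not_collinear_set.2 h
  have htop : affineSpan ℝ (Set.range ![a₁, a₂, a₃]) = ⊤ :=
    hind.affineSpan_eq_top_iff_card_eq_finrank_add_one.2 (by simp)
  obtain ⟨w, hw, hb⟩ := eq_affineCombination_of_mem_affineSpan_of_fintype
    (htop ▸ AffineSubspace.mem_top ℝ Plane b)
  refine ⟨w 0, w 1, w 2, by rw [← hw, Fin.sum_univ_three], ?_⟩
  rw [hb, Finset.affineCombination_eq_linear_combination _ _ _ hw, Fin.sum_univ_three]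
  rfl

/-- If `b` and `b'` have barycentric coordinates with respect to a triangle that are nonzero, and
either for both of them or for none of them at least two coordinates are negative, then two disjoint
segments from the vertices of the triangle to `b` and `b'` meet. -/
theorem exists_segments_inter_nonempty {a : Fin 3 → Plane} {b b' : Plane} {x y z x' y' z' : ℝ}
    (hb : b = x • a 0 + y • a 1 + z • a 2) (hb' : b' = x' • a 0 + y' • a 1 + z' • a 2)
    (hs : x + y + z = 1) (hs' : x' + y' + z' = 1) (hx : x ≠ 0) (hy : y ≠ 0) (hz : z ≠ 0)
    (hx' : x' ≠ 0) (hy' : y' ≠ 0) (hz' : z' ≠ 0) (hneg : TwoNeg x y z ↔ TwoNeg x' y' z') :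
    ∃ i j : Fin 3, i ≠ j ∧ (segment ℝ (a i) b ∩ segment ℝ (a j) b').Nonempty := by
  -- The two alternatives decide which of the two remaining corners is joined to `b` and which to
  -- `b'`.
  have hsplit : ∀ {z l m : ℝ}, 0 ≤ l * m → (0 ≤ z * l ∧ 0 ≤ z * m) ∨ (0 ≤ z * -l ∧ 0 ≤ z * -m) := by
    intro z l m h
    rcases mul_nonneg_iff.1 h with ⟨h1, h2⟩ | ⟨h1, h2⟩ <;> rcases le_total 0 z with hz | hz
    · exact Or.inl ⟨mul_nonneg hz h1, mul_nonneg hz h2⟩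
    · exact Or.inr ⟨mul_nonneg_of_nonpos_of_nonpos hz (by linarith),
        mul_nonneg_of_nonpos_of_nonpos hz (by linarith)⟩
    · exact Or.inr ⟨mul_nonneg hz (by linarith), mul_nonneg hz (by linarith)⟩
    · exact Or.inl ⟨mul_nonneg_of_nonpos_of_nonpos hz h1, mul_nonneg_of_nonpos_of_nonpos hz h2⟩
  rcases exists_agreeing_sign hx hy hz hx' hy' hz' hs hs' hneg with ⟨h, h'⟩ | ⟨h, h'⟩ | ⟨h, h'⟩
  · rcases (hsplit (z := x) h').symm with ⟨h1, h2⟩ | ⟨h1, h2⟩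
    · refine ⟨2, 1, by decide, segments_inter_nonempty (x := z) (y := y) (z := x) (x' := z')
        (y' := y') (z' := x') (a₃ := a 0) ?_ ?_ ?_ ?_ h ?_ ?_⟩ <;>
        first | linarith | (rw [hb]; abel) | (rw [hb']; abel)
    · refine ⟨1, 2, by decide, segments_inter_nonempty (x := y) (y := z) (z := x) (x' := y')
        (y' := z') (z' := x') (a₃ := a 0) ?_ ?_ ?_ ?_ h ?_ ?_⟩ <;>
        first | linarith | (rw [hb]; abel) | (rw [hb']; abel)
  · rcases (hsplit (z := y) h').symm with ⟨h1, h2⟩ | ⟨h1, h2⟩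
    · refine ⟨0, 2, by decide, segments_inter_nonempty (x := x) (y := z) (z := y) (x' := x')
        (y' := z') (z' := y') (a₃ := a 1) ?_ ?_ ?_ ?_ h ?_ ?_⟩ <;>
        first | linarith | (rw [hb]; abel) | (rw [hb']; abel)
    · refine ⟨2, 0, by decide, segments_inter_nonempty (x := z) (y := x) (z := y) (x' := z')
        (y' := x') (z' := y') (a₃ := a 1) ?_ ?_ ?_ ?_ h ?_ ?_⟩ <;>
        first | linarith | (rw [hb]; abel) | (rw [hb']; abel)
  · rcases hsplit (z := z) h' with ⟨h1, h2⟩ | ⟨h1, h2⟩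
    · refine ⟨0, 1, by decide, segments_inter_nonempty hb hb' hs hs' h ?_ ?_⟩ <;> linarith
    · refine ⟨1, 0, by decide, segments_inter_nonempty (x := y) (y := x) (z := z) (x' := y')
        (y' := x') (z' := z') (a₃ := a 2) ?_ ?_ ?_ ?_ h ?_ ?_⟩ <;>
        first | linarith | (rw [hb]; abel) | (rw [hb']; abel)

theorem ne_zero_of_barycentric {a₁ a₂ a₃ b : Plane} {x y z : ℝ}
    (h : ¬ Collinear ℝ ({b, a₂, a₃} : Set Plane)) (hs : x + y + z = 1)
    (hb : b = x • a₁ + y • a₂ + z • a₃) : x ≠ 0 := by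
  rintro rfl
  refine h (collinear_insert_of_mem_affineSpan_pair ?_)
  have : b = AffineMap.lineMap a₂ a₃ z := by
    rw [hb, AffineMap.lineMap_apply_module, ← hs]
    module
  rw [this]
  exact AffineMap.lineMap_mem_affineSpan_pair _ _ _

/-- Given a triangle with vertices in a set `P` in general position, the other points of `P` can be
divided into two classes so that, for any two points of the same class, two disjoint segments from
the vertices of the triangle to them meet. -/
theorem InGeneralPosition.exists_classes {P : Set Plane} (hP : InGeneralPosition P)
    {a : Fin 3 → Plane} (ha : Function.Injective a) (haP : ∀ i, a i ∈ P) :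
    ∃ c : Plane → Prop, ∀ b ∈ P, ∀ b' ∈ P, (∀ i, a i ≠ b) → (∀ i, a i ≠ b') → (c b ↔ c b') →
      ∃ i j : Fin 3, i ≠ j ∧ (segment ℝ (a i) b ∩ segment ℝ (a j) b').Nonempty := by
  have hne : ∀ {i j : Fin 3}, i ≠ j → a i ≠ a j := fun h => ha.ne h
  have h012 : ¬ Collinear ℝ ({a 0, a 1, a 2} : Set Plane) :=
    hP.not_collinear _ (haP 0) _ (haP 1) _ (haP 2) (hne (by decide)) (hne (by decide))
      (hne (by decide))
  choose x y z hs hb using exists_barycentric h012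
  have hnz : ∀ b ∈ P, (∀ i, a i ≠ b) → x b ≠ 0 ∧ y b ≠ 0 ∧ z b ≠ 0 := by
    intro b hbP hab
    have hcol : ∀ i j : Fin 3, i ≠ j → ¬ Collinear ℝ ({b, a i, a j} : Set Plane) := fun i j hij =>
      hP.not_collinear _ hbP _ (haP i) _ (haP j) (hab i).symm (hab j).symm (hne hij)
    refine ⟨ne_zero_of_barycentric (hcol 1 2 (by decide)) (hs b) (hb b),
      ne_zero_of_barycentric (a₁ := a 1) (y := x b) (z := z b) (hcol 0 2 (by decide)) ?_ ?_,
      ne_zero_of_barycentric (a₁ := a 2) (y := x b) (z := y b) (hcol 0 1 (by decide)) ?_ ?_⟩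
    · linarith [hs b]
    · exact (hb b).trans (by abel)
    · linarith [hs b]
    · exact (hb b).trans (by abel)
  -- One class is the three regions beyond the corners; the other is the interior and the regions
  -- beyond the sides.
  refine ⟨fun b => TwoNeg (x b) (y b) (z b), fun b hbP b' hbP' hab hab' hc => ?_⟩
  obtain ⟨h1, h2, h3⟩ := hnz b hbP hab
  obtain ⟨h1', h2', h3'⟩ := hnz b' hbP' hab'
  exact exists_segments_inter_nonempty (hb b) (hb b') (hs b) (hs b') h1 h2 h3 h1' h2' h3' hc

/-! ### Disjoint copies of `K_{3,d}` and the lower bound. -/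

/-- If `d ≥ 3` elements are divided into two classes, at least `d ^ 2 / 12` pairs of elements are in
the same class. -/
theorem sq_le_card_pairs_same_class {d : ℕ} (hd : 3 ≤ d) (c : Fin d → Prop) [DecidablePred c] :
    d ^ 2 ≤ 12 * (Finset.univ.filter fun x : Fin d × Fin d => x.1 < x.2 ∧ (c x.1 ↔ c x.2)).card := by
  set Y := Finset.univ.filter fun x : Fin d × Fin d => x.1 < x.2 ∧ (c x.1 ↔ c x.2)
  set A := Finset.univ.filter c
  have hsub : A ×ˢ A ∪ Aᶜ ×ˢ Aᶜ ⊆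
      (Y ∪ Y.image Prod.swap) ∪ Finset.univ.image fun i : Fin d => (i, i) := by
    rintro ⟨i, j⟩ h
    have hij : c i ↔ c j := by
      simp only [A, Finset.mem_union, Finset.mem_product, Finset.mem_filter, Finset.mem_univ,
        true_and, Finset.mem_compl] at h
      tauto
    simp only [Y, Finset.mem_union, Finset.mem_filter, Finset.mem_univ, true_and, Finset.mem_image,
      Prod.exists, Prod.swap_prod_mk, Prod.mk.injEq]
    rcases lt_trichotomy i j with h | h | h
    · exact Or.inl (Or.inl ⟨h, hij⟩)
    · exact Or.inr ⟨i, rfl, h⟩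
    · exact Or.inl (Or.inr ⟨j, i, ⟨h, hij.symm⟩, rfl, rfl⟩)
  have h1 : (A ×ˢ A ∪ Aᶜ ×ˢ Aᶜ).card = A.card * A.card + Aᶜ.card * Aᶜ.card := by
    rw [Finset.card_union_of_disjoint, Finset.card_product, Finset.card_product]
    exact Finset.disjoint_product.2 (Or.inl disjoint_compl_right)
  have h2 := Finset.card_le_card hsub
  have h3 := Finset.card_union_le (Y ∪ Y.image Prod.swap) (Finset.univ.image fun i : Fin d => (i, i))
  have h4 := Finset.card_union_le Y (Y.image Prod.swap)
  have h5 : (Y.image Prod.swap).card ≤ Y.card := Finset.card_image_le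
  have h6 : (Finset.univ.image fun i : Fin d => (i, i)).card ≤ d :=
    Finset.card_image_le.trans (by simp)
  have h7 : A.card + Aᶜ.card = d := by simp [Finset.card_add_card_compl]
  generalize A.card = s at *
  generalize Aᶜ.card = t at *
  subst h7
  -- With s² + t² ≥ d²/2, this gives 12|Y| ≥ 3d² − 6d, which is at least d² once `d ≥ 3`.
  have h8 : s * s + t * t ≤ 2 * Y.card + (s + t) := by omega
  zify at *
  nlinarith [sq_nonneg ((s : ℤ) - t)]

namespace SimpleGraph

theorem pathGraph_isTree (n : ℕ) : (pathGraph (n + 1)).IsTree := by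
  refine isTree_iff_connected_and_card.2 ⟨pathGraph_connected n, le_antisymm ?_ ?_⟩
  · let f : Fin n → (pathGraph (n + 1)).edgeSet := fun i =>
      ⟨s(i.castSucc, i.succ), by simp [pathGraph_adj]⟩
    have hf : Function.Surjective f := by
      rintro ⟨e, he⟩
      induction e with
      | h a b =>
        rw [mem_edgeSet, pathGraph_adj] at he
        rcases he with he | he
        · refine ⟨⟨a, by omega⟩, Subtype.ext ?_⟩
          exact congrArg₂ (fun x y => s(x, y)) (Fin.ext rfl) (Fin.ext he)
        · refine ⟨⟨b, by omega⟩, Subtype.ext ?_⟩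
          exact (congrArg₂ (fun x y => s(x, y)) (Fin.ext rfl) (Fin.ext he)).trans Sym2.eq_swap
    have := Nat.card_le_card_of_surjective f hf
    simpa using this
  · exact (pathGraph_connected n).card_vert_le_card_edgeSet_add_one

theorem connected_induce_pathGraph {n : ℕ} {S : Set (Fin n)} (hS : S.OrdConnected)
    (hne : S.Nonempty) : ((pathGraph n).induce S).Connected := by
  have key : ∀ (m : ℕ) (x z : S), (z : Fin n).val = (x : Fin n).val + m →
      ((pathGraph n).induce S).Reachable x z := by
    intro m
    induction m with
    | zero =>
      intro x z h
      rw [Subtype.ext (Fin.ext h) (a1 := z) (a2 := x)]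
    | succ m ih =>
      intro x z h
      have hy : (⟨(x : Fin n).val + m, by omega⟩ : Fin n) ∈ S :=
        hS.out x.2 z.2 ⟨Fin.le_def.2 (by simp), Fin.le_def.2 (by simp; omega)⟩
      refine (ih x ⟨_, hy⟩ rfl).trans (Adj.reachable ?_)
      simp only [comap_adj, Function.Embedding.subtype_apply, pathGraph_adj]
      omega
  have := hne.to_subtype
  refine ⟨fun x z => ?_⟩
  rcases le_total (x : Fin n).val (z : Fin n).val with h | h
  · exact key _ x z (by omega : (z : Fin n).val = (x : Fin n).val + (z - x : ℕ))
  · exact (key _ z x (by omega : (x : Fin n).val = (z : Fin n).val + (x - z : ℕ))).symm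

/-- The vertices `0, …, n - 1` are divided into blocks of `d + 3` consecutive vertices; in each block
the first three vertices are joined to all others. -/
def bipartiteBlocks (d n : ℕ) : SimpleGraph (Fin n) where
  Adj i j := i.val / (d + 3) = j.val / (d + 3) ∧ (i.val % (d + 3) < 3 ↔ ¬ j.val % (d + 3) < 3)
  symm := ⟨fun _ _ h => ⟨h.1.symm, by tauto⟩⟩
  loopless := ⟨fun _ h => by tauto⟩

variable {d n : ℕ}

theorem bipartiteBlocks_adj {i j : Fin n} : (bipartiteBlocks d n).Adj i j ↔
    i.val / (d + 3) = j.val / (d + 3) ∧ (i.val % (d + 3) < 3 ↔ ¬ j.val % (d + 3) < 3) := Iff.rfl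

theorem card_le_of_div_eq {N q : ℕ} {s : Finset (Fin n)} {t : Finset ℕ}
    (h : ∀ i ∈ s, i.val / N = q ∧ i.val % N ∈ t) : s.card ≤ t.card := by
  refine Finset.card_le_card_of_injOn (fun i => i.val % N) (fun i hi => (h i hi).2) ?_
  intro i hi j hj hij
  have h1 := Nat.div_add_mod i.val N
  have h2 := Nat.div_add_mod j.val N
  simp only at hij
  rw [(h i hi).1] at h1
  rw [(h j hj).1] at h2
  exact Fin.ext (by omega)

/-- A path decomposition: the bag of `x` is `x` with the first three vertices of its block. Each of
these three occupies the interval of its block, any other vertex a single node. -/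
theorem treewidth_bipartiteBlocks_le (hn : 0 < n) : (bipartiteBlocks d n).treewidth ≤ 3 := by
  classical
  let L : Fin n → Finset (Fin n) := fun x => Finset.univ.filter fun l : Fin n =>
    l.val / (d + 3) = x.val / (d + 3) ∧ l.val % (d + 3) < 3
  have hL : ∀ v x, v ∈ insert x (L x) ↔
      v = x ∨ v.val / (d + 3) = x.val / (d + 3) ∧ v.val % (d + 3) < 3 := by simp [L]
  obtain ⟨m, rfl⟩ : ∃ m, n = m + 1 := ⟨n - 1, by omega⟩
  let D : (bipartiteBlocks d (m + 1)).Decomposition (pathGraph (m + 1)) :=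
    { bag := fun x => insert x (L x)
      exists_bag_of_adj := by
        intro v w h
        rw [bipartiteBlocks_adj] at h
        simp only [hL]
        by_cases hv : v.val % (d + 3) < 3
        · exact ⟨w, Or.inr ⟨h.1, hv⟩, Or.inl rfl⟩
        · exact ⟨v, Or.inl rfl, Or.inr ⟨h.1.symm, by tauto⟩⟩
      connected_bags := by
        intro v
        refine connected_induce_pathGraph ⟨fun x hx z hz y hy => ?_⟩ ⟨v, by simp⟩
        rw [Set.mem_ofPred_eq, hL] at hx hz ⊢
        have h1 : x.val / (d + 3) ≤ y.val / (d + 3) := Nat.div_le_div_right hy.1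
        have h2 : y.val / (d + 3) ≤ z.val / (d + 3) := Nat.div_le_div_right hy.2
        rcases hx with rfl | hx <;> rcases hz with rfl | hz
        · exact Or.inl (le_antisymm hy.1 hy.2)
        · exact Or.inr ⟨by omega, hz.2⟩
        · exact Or.inr ⟨by omega, hx.2⟩
        · exact Or.inr ⟨by omega, hx.2⟩ }
  have hD : (bipartiteBlocks d (m + 1)).treewidth ≤ D.width :=
    Nat.sInf_le ⟨m + 1, pathGraph (m + 1), D, pathGraph_isTree m, rfl⟩
  refine hD.trans ?_
  refine Nat.sub_le_of_le_add (Finset.sup_le fun x _ => ?_)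
  refine (Finset.card_insert_le _ _).trans (Nat.add_le_add_right ?_ 1)
  refine (card_le_of_div_eq (N := d + 3) (q := x.val / (d + 3)) (t := Finset.range 3) ?_).trans
    (by simp)
  intro i hi
  simpa [L] using hi

theorem maxDegree_bipartiteBlocks (hd : 3 ≤ d) (hn : d + 3 ≤ n)
    [DecidableRel (bipartiteBlocks d n).Adj] : (bipartiteBlocks d n).maxDegree = d := by
  apply le_antisymm
  · refine maxDegree_le_of_forall_degree_le _ _ fun v => ?_
    rw [← card_neighborFinset_eq_degree]
    by_cases hv : v.val % (d + 3) < 3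
    · refine (card_le_of_div_eq (N := d + 3) (q := v.val / (d + 3)) (t := Finset.Ico 3 (d + 3))
        fun i hi => ?_).trans (by simp)
      rw [mem_neighborFinset, bipartiteBlocks_adj] at hi
      have := Nat.mod_lt i.val (by omega : 0 < d + 3)
      exact ⟨hi.1.symm, Finset.mem_Ico.2 ⟨not_lt.1 (hi.2.1 hv), this⟩⟩
    · refine (card_le_of_div_eq (N := d + 3) (q := v.val / (d + 3)) (t := Finset.range 3)
        fun i hi => ?_).trans (by simpa)
      rw [mem_neighborFinset, bipartiteBlocks_adj] at hi
      exact ⟨hi.1.symm, Finset.mem_range.2 (by tauto)⟩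
  -- The last block may be incomplete, but the first one is complete, so vertex `0` has all `d`
  -- neighbours.
  · refine le_trans ?_ (degree_le_maxDegree _ (⟨0, by omega⟩ : Fin n))
    rw [← card_neighborFinset_eq_degree]
    let f : Fin d → Fin n := fun i => ⟨3 + i, by omega⟩
    have hf : Function.Injective f := fun i j h => by
      have := congrArg Fin.val h
      simp only [f] at this
      exact Fin.ext (by omega)
    calc d = (Finset.univ.image f).card := by
            rw [Finset.card_image_of_injective _ hf, Finset.card_univ, Fintype.card_fin]
      _ ≤ _ := Finset.card_le_card fun x hx => by
        obtain ⟨i, _, rfl⟩ := Finset.mem_image.1 hx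
        rw [mem_neighborFinset, bipartiteBlocks_adj]
        have h1 : 3 + i.val < d + 3 := by omega
        simp [f, Nat.div_eq_of_lt h1, Nat.mod_eq_of_lt h1]

/-- Every rectilinear drawing of disjoint copies of `K_{3,d}` has at least `d ^ 2 / 12` crossings per
copy. -/
theorem le_rectilinearCrossingNumber_bipartiteBlocks (hd : 3 ≤ d) {m : ℕ}
    (hm : m * (d + 3) ≤ n) :
    (((m * d ^ 2 + 11) / 12 : ℕ) : ℕ∞) ≤ (bipartiteBlocks d n).rectilinearCrossingNumber := by
  classical
  -- The bound `(m * d ^ 2 + 11) / 12` is the ceiling of `m * d ^ 2 / 12`.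
  refine le_iInf fun R => ?_
  have hlt : ∀ (q : Fin m) (r : ℕ), r < d + 3 → q * (d + 3) + r < n := by
    intro q r hr
    have : (q + 1) * (d + 3) ≤ m * (d + 3) := Nat.mul_le_mul_right _ q.2
    linarith
  have hdiv : ∀ q r : ℕ, r < d + 3 → (q * (d + 3) + r) / (d + 3) = q := by
    intro q r hr
    rw [mul_comm, Nat.mul_add_div (by omega), Nat.div_eq_of_lt hr, add_zero]
  have hmod : ∀ q r : ℕ, r < d + 3 → (q * (d + 3) + r) % (d + 3) = r := by
    intro q r hr
    rw [mul_comm, Nat.mul_add_mod, Nat.mod_eq_of_lt hr]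
  let a : Fin m → Fin 3 → Fin n := fun q i => ⟨q * (d + 3) + i, hlt q i (by omega)⟩
  let b : Fin m → Fin d → Fin n := fun q j => ⟨q * (d + 3) + (3 + j), hlt q (3 + j) (by omega)⟩
  have hab : ∀ q i q' j, a q i ≠ b q' j := by
    intro q i q' j h
    have h1 := congrArg (fun x : Fin n => x.val % (d + 3)) h
    simp only [a, b] at h1
    rw [hmod _ _ (by omega), hmod _ _ (by omega)] at h1
    omega
  have hainj : ∀ q, Function.Injective (a q) := by
    intro q i j h
    have h1 := congrArg Fin.val h
    simp only [a] at h1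
    exact Fin.ext (by omega)
  have hbinj : ∀ q j q' j', b q j = b q' j' → q = q' ∧ j = j' := by
    intro q j q' j' h
    have h1 := congrArg (fun x : Fin n => x.val % (d + 3)) h
    have h2 := congrArg (fun x : Fin n => x.val / (d + 3)) h
    simp only [b] at h1 h2
    rw [hmod _ _ (by omega), hmod _ _ (by omega)] at h1
    rw [hdiv _ _ (by omega), hdiv _ _ (by omega)] at h2
    exact ⟨Fin.ext h2, Fin.ext (by omega)⟩
  have hadj : ∀ q i j, (bipartiteBlocks d n).Adj (a q i) (b q j) := by
    intro q i j
    rw [bipartiteBlocks_adj]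
    simp only [a, b]
    rw [hmod _ _ (by omega), hmod _ _ (by omega), hdiv _ _ (by omega), hdiv _ _ (by omega)]
    exact ⟨rfl, by omega⟩
  choose c hc using fun q => R.generalPosition.exists_classes (a := fun i => R.point (a q i))
    (fun i j h => hainj q (R.injective h)) (fun i => ⟨_, rfl⟩)
  choose f g hfg hcross using fun (q : Fin m) (x : Fin d × Fin d) h =>
    hc q (R.point (b q x.1)) ⟨_, rfl⟩ (R.point (b q x.2)) ⟨_, rfl⟩
    (fun i => R.injective.ne (hab q i q x.1)) (fun i => R.injective.ne (hab q i q x.2)) h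
  let Y : Fin m → Finset (Fin d × Fin d) := fun q => Finset.univ.filter fun x =>
    x.1 < x.2 ∧ (c q (R.point (b q x.1)) ↔ c q (R.point (b q x.2)))
  have hY : ∀ q x, x ∈ Y q → x.1 < x.2 ∧ (c q (R.point (b q x.1)) ↔ c q (R.point (b q x.2))) := by
    intro q x hx
    simpa [Y] using hx
  let X := Finset.univ.sigma Y
  have hX : m * d ^ 2 ≤ 12 * X.card := by
    rw [Finset.card_sigma, Finset.mul_sum]
    calc m * d ^ 2 = ∑ q : Fin m, d ^ 2 := by simp
      _ ≤ _ := Finset.sum_le_sum fun q _ =>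
        sq_le_card_pairs_same_class hd fun j => c q (R.point (b q j))
  have hXY : ∀ y ∈ X, y.2 ∈ Y y.1 := fun y hy => (Finset.mem_sigma.1 hy).2
  let F : ∀ y ∈ X, Sym2 (Sym2 (Fin n)) := fun y hy =>
    s(s(a y.1 (f y.1 y.2 (hY _ _ (hXY y hy)).2), b y.1 y.2.1),
      s(a y.1 (g y.1 y.2 (hY _ _ (hXY y hy)).2), b y.1 y.2.2))
  have hF : ∀ y hy, F y hy ∈ R.crossingPairs := by
    intro y hy
    refine ⟨_, _, rfl, hadj _ _ _, hadj _ _ _, ?_, hcross _ _ _⟩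
    rintro v ⟨h1, h2⟩
    rcases Sym2.mem_iff.1 h1 with rfl | rfl <;> rcases Sym2.mem_iff.1 h2 with h | h
    · exact hfg _ _ _ (hainj _ h)
    · exact hab _ _ _ _ h
    · exact hab _ _ _ _ h.symm
    · exact (hY _ _ (hXY y hy)).1.ne (hbinj _ _ _ _ h).2
  have hedge : ∀ q i q₁ j q' i' q₁' j', s(a q i, b q₁ j) = s(a q' i', b q₁' j') →
      q₁ = q₁' ∧ j = j' := by
    intro q i q₁ j q' i' q₁' j' h
    rcases Sym2.eq_iff.1 h with h | h
    · exact hbinj _ _ _ _ h.2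
    · exact absurd h.1 (hab _ _ _ _)
  -- The ends on the large side determine the copy and the pair; as pairs are increasing, the two
  -- edges cannot be swapped.
  have hFinj : ∀ y hy z hz, F y hy = F z hz → y = z := by
    rintro ⟨q, j, j'⟩ hy ⟨q', k, k'⟩ hz h
    rcases Sym2.eq_iff.1 h with ⟨h1, h2⟩ | ⟨h1, h2⟩
    · obtain ⟨rfl, rfl⟩ := hedge _ _ _ _ _ _ _ _ h1
      obtain ⟨-, rfl⟩ := hedge _ _ _ _ _ _ _ _ h2
      rfl
    · obtain ⟨-, rfl⟩ := hedge _ _ _ _ _ _ _ _ h1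
      obtain ⟨-, rfl⟩ := hedge _ _ _ _ _ _ _ _ h2
      exact absurd (hY _ _ (hXY _ hy)).1 (hY _ _ (hXY _ hz)).1.not_gt
  calc (((m * d ^ 2 + 11) / 12 : ℕ) : ℕ∞) ≤ (X.card : ℕ∞) := by
        exact_mod_cast (by omega : (m * d ^ 2 + 11) / 12 ≤ X.card)
    _ = ((X.attach.image fun y => F y.1 y.2).card : ℕ∞) := by
        rw [Finset.card_image_of_injective, Finset.card_attach]
        exact fun y z h => Subtype.ext (hFinj _ y.2 _ z.2 h)
    _ = ((X.attach.image fun y => F y.1 y.2 : Finset _) : Set (Sym2 (Sym2 (Fin n)))).encard :=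
        (Set.encard_coe_eq_coe_finsetCard _).symm
    _ ≤ R.crossings := Set.encard_le_encard fun q hq => by
        obtain ⟨y, _, rfl⟩ := Finset.mem_image.1 hq
        exact hF _ y.2

end SimpleGraph

/-! ### Assembly of the three statements. -/

theorem mainTheorem3 :
    (∀ k : ℕ, 1 ≤ k → ∀ (V : Type u) [Fintype V] [DecidableEq V] (G : SimpleGraph V)
      [DecidableRel G.Adj], G.treewidth ≤ k →
        G.rectilinearCrossingNumber ≤
          ((k * (k + 2) * G.maxDegree * G.edgeFinset.card : ℕ) : ℕ∞)) ∧
    (∀ k : ℕ, 1 ≤ k → ∃ c : ℕ, ∀ (V : Type u) [Fintype V] (G : SimpleGraph V)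
      [DecidableRel G.Adj], G.treewidth ≤ k →
        G.rectilinearCrossingNumber ≤ ((c * G.maxDegree * Fintype.card V : ℕ) : ℕ∞)) ∧
    (∃ C : ℕ, 0 < C ∧ ∀ d n : ℕ, 3 ≤ d → C * d ≤ n →
      ∃ (G : SimpleGraph (Fin n)) (_ : DecidableRel G.Adj),
        G.treewidth ≤ 5 ∧ G.maxDegree = d ∧
          ((d * n : ℕ) : ℕ∞) ≤ (C : ℕ∞) * G.rectilinearCrossingNumber) := by
  classical
  refine ⟨fun k _ V _ _ G _ hG => ?_, fun k _ => ⟨k * k, fun V _ G _ hG => ?_⟩,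
    48, by norm_num, fun d n hd hn => ?_⟩
  · refine (SimpleGraph.rectilinearCrossingNumber_le_of_treewidth_le hG).trans ?_
    exact_mod_cast Nat.mul_le_mul_right _ (Nat.mul_le_mul_right _
      (Nat.le_mul_of_pos_right k (by omega)))
  · refine (SimpleGraph.rectilinearCrossingNumber_le_of_treewidth_le hG).trans ?_
    have h := Nat.mul_le_mul_left (k * G.maxDegree) (SimpleGraph.card_edgeFinset_le_of_treewidth_le hG)
    exact_mod_cast h.trans_eq (by ring)
  · refine ⟨SimpleGraph.bipartiteBlocks d n, Classical.decRel _,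
      (SimpleGraph.treewidth_bipartiteBlocks_le (by omega)).trans (by norm_num),
      SimpleGraph.maxDegree_bipartiteBlocks hd (by omega), ?_⟩
    have hL := SimpleGraph.le_rectilinearCrossingNumber_bipartiteBlocks (d := d) (n := n) hd
      (Nat.div_mul_le_self n (d + 3))
    have h1 : n < (n / (d + 3) + 1) * (d + 3) := by
      rw [mul_comm]
      exact Nat.lt_mul_div_succ n (by omega)
    have h2 : 1 ≤ n / (d + 3) := (Nat.one_le_div_iff (by omega)).2 (by omega)
    generalize n / (d + 3) = m at *
    -- Rounding to whole blocks costs a factor 2 and `d + 3 ≤ 2 * d` another; with the 12 from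
    -- counting pairs this gives 48.
    have h3 : n ≤ 4 * (m * d) := by
      have : (m + 1) * (d + 3) ≤ (2 * m) * (2 * d) := Nat.mul_le_mul (by omega) (by omega)
      linarith
    have h4 : d * n ≤ 48 * ((m * d ^ 2 + 11) / 12) := by
      have h5 : d * n ≤ 4 * (m * d ^ 2) := (Nat.mul_le_mul_left d h3).trans_eq (by ring)
      omega
    calc ((d * n : ℕ) : ℕ∞) ≤ ((48 * ((m * d ^ 2 + 11) / 12) : ℕ) : ℕ∞) := by exact_mod_cast h4
      _ = 48 * (((m * d ^ 2 + 11) / 12 : ℕ) : ℕ∞) := by push_cast; rfl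
      _ ≤ _ := by
        push_cast at hL ⊢
        gcongr
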